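/- Let $H$ be a real separable Hilbert space with closed unit ball $B_1$, let $A,\tilde A$ be bounded linear operators on $H$, and let $L=(L_t)_{t\ge 0}$ be an $H$-valued Lévy process on a probability space $(\Omega,\mathcal F,\mathsf P)$ (stochastically continuous, $L_0=0$ a.s., independent and stationary increments, almost all paths càdlàg). For a Borel set $E\subset H\setminus\{0\}$ let $\pi_t(E,L)$ be the number of times $s\le t$ with $\Delta L_s:=L_s-L_{s-}\in E$, and let $\mu(E)=\mathsf E[\pi_1(E,L)]$ be the intensity measure of $L$. Suppose that $L$ is a purely jump process, i.e. $L$ has neither a Wiener part nor a drift in its Lévy–Itô decomposition: for some decreasing sequence of Borel sets $E_n\subset B_1$ with $\bigcap_n E_n=\{0\}$ and $\operatorname{dist}(0,B_1\setminus E_n)>0$ for every $n$, one has for every $t\ge0$, almost surely, $$L_t=\sum_{s\le t,\ \Delta L_s\in H\setminus B_1}\Delta L_s+\lim_{n\to\infty}\Big(\sum_{s\le t,\ \Delta L_s\in B_1\setminus E_n}\Delta L_s-t\int_{B_1\setminus E_n}u\,\mu(\mathrm du)\Big)$$ (for a Lévy process the limit exists almost surely and does not depend, up to a null set, on the choice of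 $(E_n)$). Let $T>0$, let $\mathcal D_{H,T}$ be the space of $H$-valued càdlàg functions on $[0,T]$ with the Borel $\sigma$-algebra of the Skorohod metric $\inf_\phi\max\{\sup_t|\phi(t)-t|,\ \sup_t\|f(\phi(t))-g(t)\|\}$, where $\phi$ runs over the strictly increasing maps of $[0,T]$ onto itself. Let $X_J,\tilde X_J\colon\Omega\to\mathcal D_{H,T}$ be random variables that solve $\mathrm dX=AX\,\mathrm dt+\mathrm dL$ and $\mathrm d\tilde X=\tilde A\tilde X\,\mathrm dt+\mathrm dL$ with $X_0=\tilde X_0=0$, i.e. almost surely, for all $t\in[0,T]$, $$X_J(t)=A\int_0^tX_J(s)\,\mathrm ds+L_t,\qquad \tilde X_J(t)=\tilde A\int_0^t\tilde X_J(s)\,\mathrm ds+L_t .$$ If the law of $X_J$ on $\mathcal D_{H,T}$ is absolutely continuous with respect to the law of $\tilde X_J$, then $X_J=\tilde X_J$ almost surely. -/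

import Mathlib

open MeasureTheory ProbabilityTheory Filter Set
open scoped Topology NNReal ENNReal

noncomputable section

/-! ### Càdlàg functions and the Skorohod space -/

/-- A function is càdlàg if it is right-continuous and has left limits at every point
(at a least point the condition on the left limit is void). -/
def IsCadlag {ι S : Type*} [LinearOrder ι] [TopologicalSpace ι] [TopologicalSpace S]
    (f : ι → S) : Prop :=
  ∀ t, ContinuousWithinAt f (Ici t) t ∧ ∃ l, Tendsto f (𝓝[<] t) (𝓝 l)

/-- The space of all `S`-valued càdlàg functions on `[0, T]`. -/
structure SkorohodSpace (S : Type*) [TopologicalSpace S] (T : ℝ) where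
  /-- the path itself -/
  path : Icc (0 : ℝ) T → S
  isCadlag : IsCadlag path

namespace SkorohodSpace

variable {S : Type*} [MetricSpace S] {T : ℝ}

/-- The cost of a time change `φ` (a strictly increasing map of `[0, T]` onto itself):
`max (sup_t |φ t - t|) (sup_t d (f (φ t)) (g t))`. -/
def cost (φ : Icc (0 : ℝ) T ≃o Icc (0 : ℝ) T) (f g : SkorohodSpace S T) : ℝ≥0∞ :=
  max (⨆ t, edist (φ t) t) (⨆ t, edist (f.path (φ t)) (g.path t))

lemma cost_symm (φ : Icc (0 : ℝ) T ≃o Icc (0 : ℝ) T) (f g : SkorohodSpace S T) :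
    cost φ.symm g f ≤ cost φ f g := by
  refine max_le_max (iSup_le fun t => ?_) (iSup_le fun t => ?_)
  · refine le_trans (le_of_eq ?_) (le_iSup (fun t => edist (φ t) t) (φ.symm t))
    simp [edist_comm]
  · refine le_trans (le_of_eq ?_)
      (le_iSup (fun t => edist (f.path (φ t)) (g.path t)) (φ.symm t))
    simp [edist_comm]

lemma cost_trans (φ ψ : Icc (0 : ℝ) T ≃o Icc (0 : ℝ) T) (f g h : SkorohodSpace S T) :
    cost (ψ.trans φ) f h ≤ cost φ f g + cost ψ g h := by
  refine max_le (iSup_le fun t => ?_) (iSup_le fun t => ?_)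
  · refine (edist_triangle _ (ψ t) _).trans (add_le_add ?_ ?_)
    · exact (le_iSup (fun t => edist (φ t) t) (ψ t)).trans (le_max_left _ _)
    · exact (le_iSup (fun t => edist (ψ t) t) t).trans (le_max_left _ _)
  · refine (edist_triangle _ (g.path (ψ t)) _).trans (add_le_add ?_ ?_)
    · exact (le_iSup (fun t => edist (f.path (φ t)) (g.path t)) (ψ t)).trans (le_max_right _ _)
    · exact (le_iSup (fun t => edist (g.path (ψ t)) (h.path t)) t).trans (le_max_right _ _)

/-- The Skorohod metric: the infimum of the cost over all time changes. -/
instance : PseudoEMetricSpace (SkorohodSpace S T) where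
  edist f g := ⨅ φ : Icc (0 : ℝ) T ≃o Icc (0 : ℝ) T, cost φ f g
  edist_self f := by
    refine le_antisymm (iInf_le_of_le (OrderIso.refl _) ?_) zero_le
    simp [cost]
  edist_comm f g := by
    refine le_antisymm (le_iInf fun φ => ?_) (le_iInf fun φ => ?_)
    · exact iInf_le_of_le φ.symm (cost_symm φ g f)
    · exact iInf_le_of_le φ.symm (cost_symm φ f g)
  edist_triangle f g h := by
    simp only [ENNReal.iInf_add, ENNReal.add_iInf]
    exact le_iInf fun φ => le_iInf fun ψ =>
      iInf_le_of_le (φ.trans ψ) (cost_trans ψ φ f g h)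

/-- The Skorohod space carries the Borel `σ`-algebra of the Skorohod metric. -/
instance : MeasurableSpace (SkorohodSpace S T) := borel _

instance : BorelSpace (SkorohodSpace S T) := ⟨rfl⟩

end SkorohodSpace

/-! ### Jumps of a path -/

/-- The jump `Δf(s) = f(s) - f(s-)`; it is `0` at `s = 0`. -/
def jump {H : Type*} [NormedAddCommGroup H] (f : ℝ≥0 → H) (s : ℝ≥0) : H :=
  f s - Function.leftLim f s

/-- The counting measure `π_t(·, f)` of the non-zero jumps of `f` up to time `t`. -/
def jumpMeasure {H : Type*} [NormedAddCommGroup H] [MeasurableSpace H]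
    (f : ℝ≥0 → H) (t : ℝ≥0) : Measure H :=
  Measure.sum fun s : {s : ℝ≥0 // s ≤ t ∧ jump f s ≠ 0} => Measure.dirac (jump f s)

/-- `π_t(E, f) = card {s ≤ t : Δf(s) ∈ E}` for Borel sets `E` that do not contain `0`. -/
lemma jumpMeasure_apply {H : Type*} [NormedAddCommGroup H] [MeasurableSpace H]
    (f : ℝ≥0 → H) (t : ℝ≥0) {E : Set H} (hE : MeasurableSet E) (h0 : (0 : H) ∉ E) :
    jumpMeasure f t E = (({s : ℝ≥0 | s ≤ t ∧ jump f s ∈ E}.encard : ℕ∞) : ℝ≥0∞) := by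
  have key : ∀ s : {s : ℝ≥0 // s ≤ t ∧ jump f s ≠ 0}, Measure.dirac (jump f s) E =
      {s : {s : ℝ≥0 // s ≤ t ∧ jump f s ≠ 0} | jump f s ∈ E}.indicator 1 s := fun s => by
    rw [Measure.dirac_apply' _ hE]; rfl
  rw [jumpMeasure, Measure.sum_apply _ hE, tsum_congr key, ← tsum_subtype]
  simp only [Pi.one_apply, ENNReal.tsum_const, mul_one]
  rw [ENat.card_coe_set_eq, ← Subtype.val_injective.encard_image]
  congr 2
  ext s
  simp only [mem_image, mem_ofPred_eq, Subtype.exists, exists_and_left, exists_prop]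
  constructor
  · rintro ⟨s, hs, h, rfl⟩
    exact ⟨h.1, hs⟩
  · rintro ⟨h, hs⟩
    exact ⟨s, hs, ⟨h, fun h' => h0 (h' ▸ hs)⟩, rfl⟩

/-- `Z¹_E(f, t)`, the sum of the jumps of `f` up to time `t` that lie in `E`. For a càdlàg path `f`
and a set `E` bounded away from `0` this is a finite sum. -/
def jumpSum {H : Type*} [NormedAddCommGroup H] (E : Set H) (f : ℝ≥0 → H) (t : ℝ≥0) : H :=
  ∑ᶠ s ∈ {s : ℝ≥0 | s ≤ t ∧ jump f s ∈ E}, jump f s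

/-! ### Lévy processes and their jump part -/

section Levy

variable {Ω H : Type*} [MeasurableSpace Ω] [NormedAddCommGroup H] [MeasurableSpace H]

/-- `L` is an `H`-valued Lévy process on `(Ω, P)`. -/
structure IsLevyProcess (L : ℝ≥0 → Ω → H) (P : Measure Ω) : Prop where
  measurable : ∀ t, Measurable (L t)
  zero : ∀ᵐ ω ∂P, L 0 ω = 0
  indep : HasIndepIncrements L P
  stationary : ∀ s h, IdentDistrib (fun ω => L (s + h) ω - L s ω) (fun ω => L h ω - L 0 ω) P P
  stochCont : ∀ t, TendstoInMeasure P L (𝓝 t) (L t)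
  cadlag : ∀ᵐ ω ∂P, IsCadlag fun t => L t ω

/-- The intensity measure `μ(E) = 𝔼[π_1(E, L)]` of `L`. -/
def intensityMeasure (L : ℝ≥0 → Ω → H) (P : Measure Ω) : Measure H :=
  P.bind fun ω => jumpMeasure (fun t => L t ω) 1

variable [NormedSpace ℝ H]

/-- `Z²_E(L, t) = Z¹_E(L, t) - t ∫_E u μ(du)`, the compensated sum of the jumps in `E`. -/
def compensatedJumpSum (L : ℝ≥0 → Ω → H) (P : Measure Ω) (E : Set H) (t : ℝ≥0) (ω : Ω) : H :=
  jumpSum E (fun s => L s ω) t - (t : ℝ) • ∫ u in E, u ∂(intensityMeasure L P)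

/-- The Borel sets `E n` in the closed unit ball `B₁` decrease to `{0}`, and all the complements
`B₁ \ E n` are bounded away from `0`. -/
structure IsShrinking (E : ℕ → Set H) : Prop where
  measurableSet : ∀ n, MeasurableSet (E n)
  subset : ∀ n, E n ⊆ Metric.closedBall 0 1
  antitone : Antitone E
  iInter : ⋂ n, E n = {0}
  boundedBelow : ∀ n, ∃ r > 0, ∀ u ∈ Metric.closedBall (0 : H) 1 \ E n, r ≤ ‖u‖

/-- `Z` is the jump part of `L`: for every `t`, almost surely
`Z_t = Z¹_{H \ B₁}(L, t) + lim_n Z²_{B₁ \ E n}(L, t)`, where `E n` are sets in the closed unit ball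
`B₁` that shrink to `{0}`. For a Lévy process the limit exists almost surely and, up to a null set,
does not depend on the choice of these sets. -/
def IsJumpPart (L : ℝ≥0 → Ω → H) (P : Measure Ω) (Z : ℝ≥0 → Ω → H) : Prop :=
  ∃ E : ℕ → Set H, IsShrinking E ∧ ∀ t, ∀ᵐ ω ∂P,
    Tendsto (fun n => jumpSum (Metric.closedBall 0 1)ᶜ (fun s => L s ω) t +
      compensatedJumpSum L P (Metric.closedBall 0 1 \ E n) t ω) atTop (𝓝 (Z t ω))

/-- `L` is a purely jump process: it coincides with its jump part, `L = Z`. -/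
def IsPurelyJump (L : ℝ≥0 → Ω → H) (P : Measure Ω) : Prop := IsJumpPart L P L

/-- `X` is the Ornstein–Uhlenbeck process on `[0, T]` with drift operator `A` and driving process
`L`, that is, a random variable in the Skorohod space that solves `dX = A X dt + dL`, `X_0 = 0`:
almost surely `X_t = A (∫_0^t X_s ds) + L_t` for all `t ∈ [0, T]`. -/
structure IsOUSolution {T : ℝ} (hT : 0 ≤ T) (A : H →L[ℝ] H) (L : ℝ≥0 → Ω → H) (P : Measure Ω)
    (X : Ω → SkorohodSpace H T) : Prop where
  measurable : Measurable X
  initial : ∀ᵐ ω ∂P, (X ω).path ⟨0, le_refl 0, hT⟩ = 0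
  equation : ∀ᵐ ω ∂P, ∀ t : Icc (0 : ℝ) T,
    (X ω).path t = A (∫ s in (0 : ℝ)..t, IccExtend hT (X ω).path s) + L ⟨t, t.2.1⟩ ω

end Levy

end

/-! The drift term `A ∫₀ᵗ X` is continuous in `t`, so `X`, `X'` and `L` almost surely have the same
jumps. Since `L` is purely jump, `L_t` is a limit of compensated jump sums, hence a functional of
the jumps of either solution, with deterministic compensators. For fixed `t`, let `jumpPartSet` be
the Borel set of paths `f` whose jump functional converges to `f(t) - A' ∫₀ᵗ f`. The path `X'` lies
in it almost surely, and by absolute continuity so does `X`. For `X` the same functional converges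
to `L_t`, so `L_t = X_t - A' ∫₀ᵗ X`. Right-continuity makes this hold for all `t` at once, and `X =
X'` by uniqueness for the equation with `A'` (Gronwall).

The main technical work is to show that jump sums are Borel on the Skorohod space:
`isOpen_exists_card_jumps`, `measurable_largeJumpMeasure`, `measurable_finsum_jumpAt`. -/

/-! ### Boundedness and large jumps of càdlàg functions -/

namespace IsCadlag

variable {S : Type*}

lemma tendsto_leftLim {ι : Type*} [LinearOrder ι] [TopologicalSpace ι] [OrderTopology ι]
    [TopologicalSpace S] {f : ι → S} (hf : IsCadlag f) (t : ι) :
    Tendsto f (𝓝[<] t) (𝓝 (Function.leftLim f t)) :=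
  tendsto_leftLim_of_tendsto (hf t).2

/-- A càdlàg function on a compact linear order is bounded. -/
lemma exists_norm_le {ι : Type*} [LinearOrder ι] [TopologicalSpace ι] [CompactSpace ι]
    [SeminormedAddCommGroup S] {f : ι → S} (hf : IsCadlag f) : ∃ C, ∀ t, ‖f t‖ ≤ C := by
  have hloc : ∀ t : ι, ∃ C, ∀ᶠ s in 𝓝 t, ‖f s‖ ≤ C := by
    intro t
    obtain ⟨l, hl⟩ := (hf t).2
    refine ⟨max (‖l‖ + 1) (‖f t‖ + 1), ?_⟩
    rw [← nhdsLT_sup_nhdsGE, eventually_sup]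
    constructor
    · filter_upwards [hl.norm.eventually_le_const (lt_add_one _)] with s hs
      exact hs.trans (le_max_left _ _)
    · filter_upwards [(hf t).1.norm.eventually_le_const (lt_add_one _)] with s hs
      exact hs.trans (le_max_right _ _)
  choose C hC using hloc
  obtain ⟨F, -, hF⟩ := isCompact_univ.elim_nhds_subcover (fun t => {s | ‖f s‖ ≤ C t})
    (fun t _ => hC t)
  refine ⟨∑ t ∈ F, |C t|, fun s => ?_⟩
  obtain ⟨t, ht, hs⟩ := mem_iUnion₂.1 (hF (mem_univ s))
  exact (le_trans hs (le_abs_self _)).trans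
    (Finset.single_le_sum (f := fun t => |C t|) (fun _ _ => abs_nonneg _) ht)

/-- A càdlàg function on a compact linear order has finitely many jumps bounded away from `0`. -/
lemma finite_lt_norm_sub_leftLim {ι : Type*} [LinearOrder ι] [TopologicalSpace ι]
    [OrderTopology ι] [CompactSpace ι] [NormedAddCommGroup S] {f : ι → S} (hf : IsCadlag f)
    {r : ℝ} (hr : 0 < r) : {t | r < ‖f t - Function.leftLim f t‖}.Finite := by
  have hloc : ∀ t : ι, ∀ᶠ s in 𝓝 t, s = t ∨ ‖f s - Function.leftLim f s‖ ≤ r := by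
    intro t
    -- on an open set of times where `f` stays near `l`, the jumps are small
    have key : ∀ (l : S) (F : Filter ι), Tendsto f F (𝓝 l) →
        (∀ p : ι → Prop, (∀ᶠ s in F, p s) → ∀ᶠ s in F, ∀ᶠ u in 𝓝[<] s, p u) →
        ∀ᶠ s in F, ‖f s - Function.leftLim f s‖ ≤ r := by
      intro l F hl hF
      have h1 : ∀ᶠ s in F, dist (f s) l < r / 2 := hl (Metric.ball_mem_nhds _ (half_pos hr))
      filter_upwards [h1, hF _ h1] with s hs hs'
      -- With no points to the left of `s`, `leftLim f s` defaults to `f s` and the jump is `0`.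
      rcases eq_or_neBot (𝓝[<] s) with hbot | hne
      · rw [leftLim_eq_of_eq_bot _ hbot]; simpa using hr.le
      · have h2 : dist (Function.leftLim f s) l ≤ r / 2 :=
          le_of_tendsto ((hf.tendsto_leftLim s).dist tendsto_const_nhds)
            (hs'.mono fun _ h => h.le)
        rw [← dist_eq_norm]
        linarith [dist_triangle_right (f s) (Function.leftLim f s) l]
    have hlt := key _ (𝓝[<] t) (hf.tendsto_leftLim t) fun p hp => by
      filter_upwards [eventually_eventually_nhdsWithin.2 hp, self_mem_nhdsWithin] with s hs hst
      rw [nhdsWithin_eq_nhds.2 (isOpen_Iio.mem_nhds hst)] at hs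
      exact hs.filter_mono nhdsWithin_le_nhds
    have hgt := key _ (𝓝[>] t) ((hf t).1.mono Ioi_subset_Ici_self) fun p hp => by
      filter_upwards [eventually_eventually_nhdsWithin.2 hp, self_mem_nhdsWithin] with s hs hst
      rw [nhdsWithin_eq_nhds.2 (isOpen_Ioi.mem_nhds hst)] at hs
      exact hs.filter_mono nhdsWithin_le_nhds
    have hne : ∀ᶠ s in 𝓝[≠] t, ‖f s - Function.leftLim f s‖ ≤ r := by
      rw [← nhdsLT_sup_nhdsGT, eventually_sup]
      exact ⟨hlt, hgt⟩
    filter_upwards [eventually_nhdsWithin_iff.1 hne] with s hs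
    by_cases h : s = t
    · exact Or.inl h
    · exact Or.inr (hs h)
  obtain ⟨F, -, hF⟩ := isCompact_univ.elim_nhds_subcover
    (fun t => {s | s = t ∨ ‖f s - Function.leftLim f s‖ ≤ r}) (fun t _ => hloc t)
  refine F.finite_toSet.subset fun s hs => ?_
  obtain ⟨t, ht, h | h⟩ := mem_iUnion₂.1 (hF (mem_univ s))
  · exact h ▸ ht
  · exact absurd h (not_le.2 hs)

end IsCadlag

/-! ### Measurability of evaluations and time integrals -/

namespace SkorohodSpace

section Metric

variable {S : Type*} [MetricSpace S] {T : ℝ}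

/-- Paths that are close in the Skorohod metric are uniformly close after a small time change. -/
lemma eventually_exists_timeChange (f : SkorohodSpace S T) {δ : ℝ≥0∞} (hδ : 0 < δ) :
    ∀ᶠ g in 𝓝 f, ∃ φ : Icc (0 : ℝ) T ≃o Icc (0 : ℝ) T,
      ∀ t, edist (φ t) t < δ ∧ edist (g.path (φ t)) (f.path t) < δ := by
  filter_upwards [Metric.eball_mem_nhds f hδ] with g hg
  obtain ⟨φ, hφ⟩ := iInf_lt_iff.1 (show ⨅ φ : Icc (0 : ℝ) T ≃o Icc (0 : ℝ) T, cost φ g f < δ from hg)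
  refine ⟨φ, fun t => ⟨?_, ?_⟩⟩
  · exact ((le_iSup (fun t => edist (φ t) t) t).trans (le_max_left _ _)).trans_lt hφ
  · exact ((le_iSup (fun t => edist (g.path (φ t)) (f.path t)) t).trans
      (le_max_right _ _)).trans_lt hφ

/-- The paths whose graph meets a given open set form an open set. -/
lemma isOpen_exists_mem {U : Set (Icc (0 : ℝ) T × S)} (hU : IsOpen U) :
    IsOpen {f : SkorohodSpace S T | ∃ t, (t, f.path t) ∈ U} := by
  rw [isOpen_iff_eventually]
  rintro f ⟨t, ht⟩
  obtain ⟨ε, hε, hball⟩ := EMetric.isOpen_iff.1 hU _ ht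
  filter_upwards [f.eventually_exists_timeChange hε] with g ⟨φ, hφ⟩
  exact ⟨φ t, hball (max_lt (hφ t).1 (hφ t).2)⟩

/-- At the endpoint `T`, fixed by every time change, evaluation is continuous. At `t < T` it need
not be, but right-continuity describes `f(t) ∈ C`, for closed `C`, by countably many conditions that
the graph meets an open set just to the right of `t`. -/
lemma measurable_eval [MeasurableSpace S] [BorelSpace S] (t : Icc (0 : ℝ) T) :
    Measurable fun f : SkorohodSpace S T => f.path t := by
  rcases t.2.2.eq_or_lt with hT | hT
  · have hfix : ∀ φ : Icc (0 : ℝ) T ≃o Icc (0 : ℝ) T, φ t = t := fun φ => by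
      have htop : ∀ s : Icc (0 : ℝ) T, s ≤ t := fun s => by
        rw [← Subtype.coe_le_coe, hT]; exact s.2.2
      exact (htop _).antisymm (φ.symm_apply_le.1 (htop _))
    refine Continuous.measurable (continuous_iff_continuousAt.2 fun f => ?_)
    refine EMetric.tendsto_nhds.2 fun ε hε => ?_
    filter_upwards [f.eventually_exists_timeChange hε] with g ⟨φ, hφ⟩
    simpa [hfix] using (hφ t).2
  · refine measurable_of_isClosed fun C hC => ?_
    have hne : (𝓝[>] t).NeBot := nhdsGT_neBot_of_exists_gt ⟨⟨T, t.2.1.trans t.2.2, le_rfl⟩, hT⟩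
    have hset : (fun f : SkorohodSpace S T => f.path t) ⁻¹' C = ⋂ m : ℕ,
        {f : SkorohodSpace S T | ∃ s, (s, f.path s) ∈
          (Ioi t ∩ Metric.ball t (1 / (m + 1))) ×ˢ Metric.thickening (1 / (m + 1)) C} := by
      ext f
      simp only [mem_preimage, mem_iInter, mem_ofPred_eq, mem_prod]
      constructor
      · intro hf m
        have hm : (0 : ℝ) < 1 / (m + 1) := Nat.one_div_pos_of_nat
        have h1 : ∀ᶠ s in 𝓝[>] t, f.path s ∈ Metric.thickening (1 / (m + 1)) C :=
          ((f.isCadlag t).1.mono Ioi_subset_Ici_self)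
            (Metric.isOpen_thickening.mem_nhds (Metric.self_subset_thickening hm C hf))
        obtain ⟨s, hs⟩ := (h1.and (inter_mem self_mem_nhdsWithin
          (mem_nhdsWithin_of_mem_nhds (Metric.ball_mem_nhds t hm)))).exists
        exact ⟨s, hs.2, hs.1⟩
      · intro h
        by_contra hf
        obtain ⟨ε, hε, hball⟩ := Metric.isOpen_iff.1 hC.isOpen_compl _ hf
        have h1 : ∀ᶠ s in 𝓝[>] t, dist (f.path s) (f.path t) < ε / 2 :=
          ((f.isCadlag t).1.mono Ioi_subset_Ici_self) (Metric.ball_mem_nhds _ (half_pos hε))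
        obtain ⟨δ, hδ, hδ'⟩ := Metric.mem_nhdsWithin_iff.1 h1
        obtain ⟨m, hm⟩ := exists_nat_one_div_lt (lt_min hδ (half_pos hε))
        obtain ⟨s, ⟨hst, hs⟩, hsC⟩ := h m
        obtain ⟨c, hc, hsc⟩ := Metric.mem_thickening_iff.1 hsC
        have h2 : dist (f.path s) (f.path t) < ε / 2 :=
          hδ' ⟨Metric.ball_subset_ball (hm.le.trans (min_le_left _ _)) hs, hst⟩
        refine hball (a := c) ?_ hc
        rw [Metric.mem_ball]
        linarith [dist_triangle_left c (f.path t) (f.path s), min_le_right δ (ε / 2)]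
    rw [hset]
    exact MeasurableSet.iInter fun m => (isOpen_exists_mem
      ((isOpen_Ioi.inter Metric.isOpen_ball).prod Metric.isOpen_thickening)).measurableSet

/-- The evaluation map `(t, f) ↦ f t` is jointly measurable. -/
lemma measurable_uncurry_eval [MeasurableSpace S] [BorelSpace S] :
    Measurable fun p : Icc (0 : ℝ) T × SkorohodSpace S T => p.2.path p.1 := by
  rcases lt_or_ge T 0 with hT | hT
  · have : IsEmpty (Icc (0 : ℝ) T) := isEmpty_coe_sort.2 (Icc_eq_empty hT.not_ge)
    exact measurable_of_empty _
  -- The `+ 1` in the numerator puts the grid point at or to the right of `t`, where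
  -- right-continuity applies.
  let d : ℕ → ℕ → Icc (0 : ℝ) T := fun n k => projIcc 0 T hT ((k + 1 : ℝ) / (n + 1))
  let k : ℕ → Icc (0 : ℝ) T → ℕ := fun n t => ⌊(t : ℝ) * (n + 1)⌋₊
  have hk : ∀ n, Measurable (k n) := fun n =>
    Nat.measurable_floor.comp (measurable_subtype_coe.mul_const _)
  have hle : ∀ n t, t ≤ d n (k n t) := fun n t => by
    have h1 : (t : ℝ) ≤ (k n t + 1 : ℝ) / (n + 1) := by
      rw [le_div_iff₀ (by positivity)]
      exact (Nat.lt_floor_add_one _).le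
    have := monotone_projIcc hT h1
    rwa [projIcc_val] at this
  have hlim : ∀ t, Tendsto (fun n => d n (k n t)) atTop (𝓝 t) := fun t => by
    have h0 : Tendsto (fun n : ℕ => (t : ℝ) + 1 / ((n : ℝ) + 1)) atTop (𝓝 (t + 0)) :=
      tendsto_const_nhds.add tendsto_one_div_add_atTop_nhds_zero_nat
    rw [add_zero] at h0
    have h1 : Tendsto (fun n : ℕ => ((k n t + 1 : ℝ) / (n + 1))) atTop (𝓝 t) := by
      refine tendsto_of_tendsto_of_tendsto_of_le_of_le tendsto_const_nhds h0 (fun n => ?_)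
        fun n => ?_
      · simp only
        rw [le_div_iff₀ (by positivity)]
        exact (Nat.lt_floor_add_one _).le
      · simp only
        rw [add_div]
        gcongr
        rw [div_le_iff₀ (by positivity)]
        exact Nat.floor_le (mul_nonneg t.2.1 (by positivity))
    have h2 := (continuous_projIcc (h := hT)).continuousAt.tendsto.comp h1
    rwa [projIcc_val] at h2
  refine measurable_of_tendsto_metrizable (f := fun n (p : Icc (0 : ℝ) T × SkorohodSpace S T) =>
    p.2.path (d n (k n p.1))) (fun n => ?_) (tendsto_pi_nhds.2 fun p => ?_)
  · have h3 : Measurable fun q : ℕ × SkorohodSpace S T => q.2.path (d n q.1) :=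
      measurable_from_prod_countable_right fun j => measurable_eval (d n j)
    exact h3.comp (((hk n).comp measurable_fst).prodMk measurable_snd)
  · have h4 : Tendsto (fun n => d n (k n p.1)) atTop (𝓝[≥] p.1) :=
      tendsto_nhdsWithin_iff.2 ⟨hlim _, Eventually.of_forall fun n => hle n _⟩
    exact ((p.2.isCadlag p.1).1.tendsto).comp h4

end Metric

section Integral

variable {H : Type*} [NormedAddCommGroup H] {T : ℝ}

lemma measurable_iccExtend [MeasurableSpace H] [BorelSpace H] (hT : 0 ≤ T)
    (f : SkorohodSpace H T) : Measurable (IccExtend hT f.path) :=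
  (measurable_uncurry_eval.comp measurable_prodMk_right).comp
    (continuous_projIcc (h := hT)).measurable

variable [SecondCountableTopology H]

lemma intervalIntegrable_iccExtend (hT : 0 ≤ T) (f : SkorohodSpace H T) (a b : ℝ) :
    IntervalIntegrable (IccExtend hT f.path) volume a b := by
  borelize H
  obtain ⟨C, hC⟩ := f.isCadlag.exists_norm_le
  refine (intervalIntegrable_const (c := C)).mono_fun
    (measurable_iccExtend hT f).aestronglyMeasurable (ae_of_all _ fun s => ?_)
  exact (hC _).trans (le_abs_self C)

lemma measurable_intervalIntegral_iccExtend [NormedSpace ℝ H] [MeasurableSpace H] [BorelSpace H]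
    (hT : 0 ≤ T) (a b : ℝ) :
    Measurable fun f : SkorohodSpace H T => ∫ s in a..b, IccExtend hT f.path s := by
  have h : Measurable fun p : SkorohodSpace H T × ℝ => IccExtend hT p.1.path p.2 :=
    measurable_uncurry_eval.comp
      (((continuous_projIcc (h := hT)).measurable.comp measurable_snd).prodMk measurable_fst)
  simp only [intervalIntegral]
  exact (h.stronglyMeasurable.integral_prod_right (ν := volume.restrict (Ioc a b))).measurable.sub
    (h.stronglyMeasurable.integral_prod_right (ν := volume.restrict (Ioc b a))).measurable

end Integral
end SkorohodSpace

/-! ### Jumps as Borel functionals of the path -/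

namespace SkorohodSpace

variable {H : Type*} [NormedAddCommGroup H] {T : ℝ}

/-- The jump `f(t) - f(t-)` of a path in the Skorohod space. -/
noncomputable def jumpAt (f : SkorohodSpace H T) (t : Icc (0 : ℝ) T) : H :=
  f.path t - Function.leftLim f.path t

/-- A time change is an increasing homeomorphism, so it carries left neighbourhoods to left
neighbourhoods, and the bound passes to the limit. -/
lemma edist_leftLim_le {f g : SkorohodSpace H T} {φ : Icc (0 : ℝ) T ≃o Icc (0 : ℝ) T} {δ : ℝ≥0∞}
    (h : ∀ t, edist (g.path (φ t)) (f.path t) ≤ δ) (t : Icc (0 : ℝ) T) :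
    edist (Function.leftLim g.path (φ t)) (Function.leftLim f.path t) ≤ δ := by
  have hmap : map φ (𝓝[<] t) = 𝓝[<] (φ t) := by
    have := φ.toHomeomorph.isEmbedding.map_nhdsWithin_eq (Iio t) t
    simpa using this
  rcases eq_or_neBot (𝓝[<] t) with hbot | hne
  · rw [leftLim_eq_of_eq_bot _ hbot, leftLim_eq_of_eq_bot _ (by rw [← hmap, hbot, map_bot])]
    exact h t
  · have hg : Tendsto (fun s => g.path (φ s)) (𝓝[<] t) (𝓝 (Function.leftLim g.path (φ t))) :=
      (g.isCadlag.tendsto_leftLim (φ t)).comp (tendsto_iff_comap.2 (by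
        rw [← hmap]; exact le_comap_map))
    exact le_of_tendsto (hg.edist (f.isCadlag.tendsto_leftLim t)) (Eventually.of_forall h)

lemma edist_jumpAt_le {f g : SkorohodSpace H T} {φ : Icc (0 : ℝ) T ≃o Icc (0 : ℝ) T} {δ : ℝ≥0∞}
    (h : ∀ t, edist (g.path (φ t)) (f.path t) ≤ δ) (t : Icc (0 : ℝ) T) :
    edist (g.jumpAt (φ t)) (f.jumpAt t) ≤ δ + δ := by
  rw [jumpAt, jumpAt, sub_eq_add_neg, sub_eq_add_neg]
  refine (edist_add_add_le _ _ _ _).trans (add_le_add (h t) ?_)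
  rw [edist_neg_neg]
  exact edist_leftLim_le h t

/-- Having at least `k` jumps in an open set is an open condition on the path. -/
lemma isOpen_exists_card_jumps {U : Set (Icc (0 : ℝ) T × H)} (hU : IsOpen U) (k : ℕ) :
    IsOpen {f : SkorohodSpace H T | ∃ F : Finset (Icc (0 : ℝ) T), F.card = k ∧
      ∀ t ∈ F, (t, f.jumpAt t) ∈ U} := by
  rw [isOpen_iff_eventually]
  rintro f ⟨F, hF, hFU⟩
  have hε : ∀ t : Icc (0 : ℝ) T, ∃ ε > 0, t ∈ F → Metric.eball (t, f.jumpAt t) ε ⊆ U := fun t => by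
    by_cases ht : t ∈ F
    · obtain ⟨ε, hε, h⟩ := EMetric.isOpen_iff.1 hU _ (hFU t ht)
      exact ⟨ε, hε, fun _ => h⟩
    · exact ⟨1, one_pos, fun h => absurd h ht⟩
  choose ε hε hball using hε
  obtain ⟨δ, hδ, hδε⟩ := exists_between
    ((Finset.lt_inf_iff (s := F) (f := ε) ENNReal.zero_lt_top).2 fun t _ => hε t)
  -- The value and the left limit each move by at most `δ / 2`, so a jump moves by at most `δ`;
  -- injectivity of `φ` preserves the number of jump times.
  filter_upwards [f.eventually_exists_timeChange (ENNReal.half_pos hδ.ne')] with g ⟨φ, hφ⟩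
  refine ⟨F.map φ.toEquiv.toEmbedding, by rw [Finset.card_map, hF], fun s hs => ?_⟩
  obtain ⟨t, ht, rfl⟩ := Finset.mem_map.1 hs
  have hlt : δ < ε t := hδε.trans_le (Finset.inf_le ht)
  refine hball t ht (Metric.mem_eball.2 (max_lt ?_ ?_))
  · exact ((hφ t).1.trans_le ENNReal.half_le_self).trans hlt
  · refine (edist_jumpAt_le (fun t => (hφ t).2.le) t).trans_lt ?_
    rwa [ENNReal.add_halves]

/-- The times of the jumps of norm larger than `r`. -/
noncomputable def largeJumps (f : SkorohodSpace H T) {r : ℝ} (hr : 0 < r) :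
    Finset (Icc (0 : ℝ) T) :=
  (f.isCadlag.finite_lt_norm_sub_leftLim hr).toFinset

lemma mem_largeJumps {f : SkorohodSpace H T} {r : ℝ} {hr : 0 < r} {t : Icc (0 : ℝ) T} :
    t ∈ f.largeJumps hr ↔ r < ‖f.jumpAt t‖ := by
  simp [largeJumps, jumpAt]

variable [MeasurableSpace H]

/-- The counting measure of the pairs (time, jump) with jumps of norm larger than `r`. -/
noncomputable def largeJumpMeasure {r : ℝ} (hr : 0 < r) (f : SkorohodSpace H T) :
    Measure (Icc (0 : ℝ) T × H) :=
  ∑ t ∈ f.largeJumps hr, Measure.dirac (t, f.jumpAt t)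

instance {r : ℝ} (hr : 0 < r) (f : SkorohodSpace H T) :
    IsFiniteMeasure (largeJumpMeasure hr f) := by
  unfold largeJumpMeasure; infer_instance

open Classical in
lemma largeJumpMeasure_apply {r : ℝ} (hr : 0 < r) (f : SkorohodSpace H T)
    {U : Set (Icc (0 : ℝ) T × H)} (hU : MeasurableSet U) :
    largeJumpMeasure hr f U = ((f.largeJumps hr).filter fun t => (t, f.jumpAt t) ∈ U).card := by
  simp only [largeJumpMeasure, Measure.coe_finsetSum, Finset.sum_apply, Measure.dirac_apply' _ hU,
    indicator_apply, Pi.one_apply, Finset.sum_boole]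

variable [BorelSpace H] [SecondCountableTopology H]

/-- On an open set the count is lower semicontinuous, because `r < ‖u‖` is an open condition; open
sets form a π-system generating the Borel sets. -/
lemma measurable_largeJumpMeasure {r : ℝ} (hr : 0 < r) :
    Measurable (largeJumpMeasure hr : SkorohodSpace H T → _) := by
  classical
  have hopen : ∀ U : Set (Icc (0 : ℝ) T × H), IsOpen U →
      Measurable fun f : SkorohodSpace H T => largeJumpMeasure hr f U := fun U hU => by
    refine LowerSemicontinuous.measurable (lowerSemicontinuous_iff_isOpen_preimage.2 fun a => ?_)
    refine isOpen_iff_mem_nhds.2 fun f hf => ?_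
    have hV : IsOpen (U ∩ {p : Icc (0 : ℝ) T × H | r < ‖p.2‖}) :=
      hU.inter (isOpen_lt continuous_const continuous_snd.norm)
    rw [mem_preimage, largeJumpMeasure_apply hr f hU.measurableSet] at hf
    refine mem_of_superset ((isOpen_exists_card_jumps hV _).mem_nhds
      ⟨(f.largeJumps hr).filter fun t => (t, f.jumpAt t) ∈ U, rfl, fun t ht => ?_⟩) ?_
    · rw [Finset.mem_filter, mem_largeJumps] at ht
      exact ⟨ht.2, ht.1⟩
    · rintro g ⟨F, hF, hFU⟩
      rw [mem_preimage, largeJumpMeasure_apply hr g hU.measurableSet]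
      refine lt_of_lt_of_le (mem_Ioi.1 hf) ?_
      rw [← hF, Nat.cast_le]
      exact Finset.card_le_card fun t ht =>
        Finset.mem_filter.2 ⟨mem_largeJumps.2 (hFU t ht).2, (hFU t ht).1⟩
  exact Measurable.measure_of_isPiSystem (BorelSpace.measurable_eq (α := Icc (0 : ℝ) T × H))
    isPiSystem_isOpen hopen (hopen _ isOpen_univ)

variable [NormedSpace ℝ H]

/-- The total masses have no uniform bound over paths. Dividing by the mass gives a finite kernel,
and the mass returns as a measurable scalar factor. -/
lemma measurable_integral_largeJumpMeasure {r : ℝ} (hr : 0 < r) {F : Icc (0 : ℝ) T × H → H}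
    (hF : Measurable F) :
    Measurable fun f : SkorohodSpace H T => ∫ p, F p ∂(largeJumpMeasure hr f) := by
  have hmass : Measurable fun f : SkorohodSpace H T => largeJumpMeasure hr f univ :=
    Measure.measurable_measure.1 (measurable_largeJumpMeasure hr) _ MeasurableSet.univ
  let κ : Kernel (SkorohodSpace H T) (Icc (0 : ℝ) T × H) :=
    ⟨fun f => (largeJumpMeasure hr f univ)⁻¹ • largeJumpMeasure hr f,
      Measure.measurable_of_measurable_coe _ fun s hs => by
        simpa [Pi.mul_def] using hmass.inv.mul
          (Measure.measurable_measure.1 (measurable_largeJumpMeasure hr) _ hs)⟩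
  have hκ : IsFiniteKernel κ := ⟨1, ENNReal.one_lt_top, fun f => by
    simp [κ, ENNReal.inv_mul_le_one]⟩
  have hint : ∀ f : SkorohodSpace H T, ∫ p, F p ∂(largeJumpMeasure hr f) =
      (largeJumpMeasure hr f univ).toReal • ∫ p, F p ∂(κ f) := fun f => by
    change _ = _ • ∫ p, F p ∂((largeJumpMeasure hr f univ)⁻¹ • largeJumpMeasure hr f)
    rcases eq_or_ne (largeJumpMeasure hr f) 0 with h0 | h0
    · simp [h0]
    · rw [integral_smul_measure, smul_smul, ← ENNReal.toReal_mul, ENNReal.mul_inv_cancel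
        (by simpa using h0) (measure_ne_top _ _), ENNReal.toReal_one, one_smul]
  simp only [hint]
  exact hmass.ennreal_toReal.smul
    (StronglyMeasurable.integral_kernel (κ := κ) hF.stronglyMeasurable).measurable

/-- The sum of the jumps up to time `t` that lie in a set bounded away from `0` is a measurable
function of the path. -/
lemma measurable_finsum_jumpAt [CompleteSpace H] {E : Set H} (hE : MeasurableSet E) {r : ℝ} (hr : 0 < r)
    (hEr : ∀ u ∈ E, r < ‖u‖) (t : Icc (0 : ℝ) T) :
    Measurable fun f : SkorohodSpace H T => ∑ᶠ s ∈ {s | s ≤ t ∧ f.jumpAt s ∈ E}, f.jumpAt s := by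
  classical
  have hS : MeasurableSet (Iic t ×ˢ E) := measurableSet_Iic.prod hE
  -- The integral of this function against `largeJumpMeasure hr f` is the jump sum, as jumps in `E`
  -- have norm larger than `r`.
  have hF : Measurable ((Iic t ×ˢ E).indicator fun p : Icc (0 : ℝ) T × H => p.2) :=
    measurable_snd.indicator hS
  convert measurable_integral_largeJumpMeasure hr hF using 2 with f
  rw [largeJumpMeasure, integral_finsetSum_measure fun s _ => ?_, finsum_mem_def,
    finsum_eq_sum_of_support_subset (s := f.largeJumps hr)]
  · simp only [integral_dirac]
    rfl
  · intro s hs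
    exact mem_largeJumps.2 (hEr _ (mem_of_indicator_ne_zero hs).2)
  · exact integrable_dirac (by simp)

end SkorohodSpace

/-! ### Comparison with the driving path and uniqueness of solutions -/

namespace SkorohodSpace

variable {H : Type*} [NormedAddCommGroup H] {T : ℝ}

/-- A time in `[0, T]` as a nonnegative real number. -/
def time (t : Icc (0 : ℝ) T) : ℝ≥0 := ⟨t, (mem_Icc.1 t.2).1⟩

lemma coe_time (t : Icc (0 : ℝ) T) : (time t : ℝ) = t := rfl

lemma continuous_time : Continuous (time (T := T)) := continuous_subtype_val.subtype_mk _

lemma time_injective : Function.Injective (time (T := T)) := fun _ _ h =>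
  Subtype.ext (congrArg NNReal.toReal h)

/-- Two paths that differ by a continuous function have the same jumps. -/
lemma jumpAt_eq_jump {f : SkorohodSpace H T} {c : Icc (0 : ℝ) T → H} (hc : Continuous c)
    {l : ℝ≥0 → H} (hl : IsCadlag l) (h : ∀ t, f.path t = c t + l (time t))
    (t : Icc (0 : ℝ) T) : f.jumpAt t = jump l (time t) := by
  unfold jumpAt jump
  -- At time `0` both left limits take their default values, so both jumps vanish.
  rcases t.2.1.eq_or_lt with h0 | h0
  · have h1 : IsBot t := fun s => by rw [← Subtype.coe_le_coe, ← h0]; exact s.2.1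
    have h2 : IsBot (time t : ℝ≥0) := fun s => by
      rw [← NNReal.coe_le_coe, coe_time, ← h0]; exact s.2
    rw [leftLim_eq_of_isBot h1, leftLim_eq_of_isBot h2, sub_self, sub_self]
  · have hne : (𝓝[<] t).NeBot :=
      nhdsLT_neBot_of_exists_lt ⟨⟨0, le_rfl, t.2.1.trans t.2.2⟩, h0⟩
    have hι : Tendsto (time (T := T)) (𝓝[<] t)
        (𝓝[<] (time t)) := by
      refine tendsto_nhdsWithin_iff.2 ⟨?_, ?_⟩
      · exact (continuous_time.tendsto t).mono_left nhdsWithin_le_nhds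
      · filter_upwards [self_mem_nhdsWithin] with s hs
        exact hs
    have hlim : Tendsto f.path (𝓝[<] t) (𝓝 (c t + Function.leftLim l (time t))) := by
      rw [show f.path = fun t => c t + l (time t) from funext h]
      exact ((hc.tendsto t).mono_left nhdsWithin_le_nhds).add ((hl.tendsto_leftLim _).comp hι)
    rw [leftLim_eq_of_tendsto hlim, h t]
    abel

lemma jumpSum_eq_finsum_jumpAt {f : SkorohodSpace H T} {l : ℝ≥0 → H}
    (h : ∀ t, f.jumpAt t = jump l (time t)) (E : Set H) (t : Icc (0 : ℝ) T) :
    jumpSum E l (time t) = ∑ᶠ s ∈ {s | s ≤ t ∧ f.jumpAt s ∈ E}, f.jumpAt s := by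
  have himage : {s : ℝ≥0 | s ≤ (time t) ∧ jump l s ∈ E} =
      time '' {s | s ≤ t ∧ f.jumpAt s ∈ E} := by
    ext s
    constructor
    · rintro ⟨hs, hsE⟩
      have hsT : (s : ℝ) ∈ Icc (0 : ℝ) T := ⟨s.2, le_trans hs t.2.2⟩
      exact ⟨⟨s, hsT⟩, ⟨hs, (h ⟨s, hsT⟩).symm ▸ hsE⟩, rfl⟩
    · rintro ⟨s, ⟨hs, hsE⟩, rfl⟩
      exact ⟨hs, h s ▸ hsE⟩
  unfold jumpSum
  rw [himage, finsum_mem_image]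
  · simp only [h]
  · exact time_injective.injOn

variable [NormedSpace ℝ H] [SecondCountableTopology H]

lemma continuous_apply_intervalIntegral (hT : 0 ≤ T) (A : H →L[ℝ] H) (f : SkorohodSpace H T) :
    Continuous fun t : Icc (0 : ℝ) T => A (∫ s in (0 : ℝ)..t, IccExtend hT f.path s) :=
  A.continuous.comp ((intervalIntegral.continuous_primitive
    (intervalIntegrable_iccExtend hT f) 0).comp continuous_subtype_val)

/-- The solution of the integral equation `f(t) = A ∫_0^t f(s) ds + l(t)` is unique. -/
lemma eq_of_integral_equation [CompleteSpace H] (hT : 0 ≤ T) (A : H →L[ℝ] H)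
    {f g : SkorohodSpace H T} {l : Icc (0 : ℝ) T → H}
    (hf : ∀ t : Icc (0 : ℝ) T, f.path t = A (∫ s in (0 : ℝ)..t, IccExtend hT f.path s) + l t)
    (hg : ∀ t : Icc (0 : ℝ) T, g.path t = A (∫ s in (0 : ℝ)..t, IccExtend hT g.path s) + l t) :
    f = g := by
  let d : ℝ → H := fun s => IccExtend hT f.path s - IccExtend hT g.path s
  let D : ℝ → H := fun t => ∫ s in (0 : ℝ)..t, d s
  have hsub : ∀ t, D t = (∫ s in (0 : ℝ)..t, IccExtend hT f.path s) -
      ∫ s in (0 : ℝ)..t, IccExtend hT g.path s := fun t =>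
    intervalIntegral.integral_sub (intervalIntegrable_iccExtend hT f 0 t)
      (intervalIntegrable_iccExtend hT g 0 t)
  have hpath : ∀ t : Icc (0 : ℝ) T, f.path t - g.path t = A (D t) := fun t => by
    rw [hf t, hg t, hsub, map_sub]; abel
  have hD : Continuous D := intervalIntegral.continuous_primitive
    (fun a b => (intervalIntegrable_iccExtend hT f a b).sub
      (intervalIntegrable_iccExtend hT g a b)) 0
  -- Although `f` and `g` are only càdlàg, their difference is continuous. Hence `D` is
  -- differentiable with `D' = A D` on `[0, T]` and `D 0 = 0`, and Gronwall applies.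
  have hd : d = fun t => A (D (projIcc 0 T hT t)) := funext fun t => hpath (projIcc 0 T hT t)
  have hdc : Continuous d := by
    rw [hd]
    exact A.continuous.comp (hD.comp (continuous_subtype_val.comp continuous_projIcc))
  have hderiv : ∀ t, HasDerivAt D (d t) t := fun t =>
    intervalIntegral.integral_hasDerivAt_right (hdc.intervalIntegrable _ _)
      hdc.stronglyMeasurable.stronglyMeasurableAtFilter hdc.continuousAt
  have hzero : ∀ t ∈ Icc (0 : ℝ) T, D t = 0 := fun t ht => by
    have := norm_le_gronwallBound_of_norm_deriv_right_le (f := D) (f' := d) (δ := 0) (K := ‖A‖)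
      (ε := 0) (a := 0) (b := T) hD.continuousOn (fun s _ => (hderiv s).hasDerivWithinAt)
      (by simp [D]) (fun s hs => by
        rw [hd, add_zero]
        simp only [projIcc_of_mem hT (Ico_subset_Icc_self hs)]
        exact A.le_opNorm _) t ht
    rw [gronwallBound_ε0_δ0] at this
    exact norm_le_zero_iff.1 this
  have hfg : f.path = g.path := funext fun t => by
    rw [← sub_eq_zero, hpath, hzero t t.2, map_zero]
  cases f; cases g; cases hfg; rfl

/-- Two functions continuous from the right on `[0, T]` that agree at `T` and at a dense set of
times are equal. -/
lemma path_eq_of_dense {S : Type*} [TopologicalSpace S] [T2Space S]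
    {f g : Icc (0 : ℝ) T → S} (hf : ∀ t, ContinuousWithinAt f (Ici t) t)
    (hg : ∀ t, ContinuousWithinAt g (Ici t) t) {D : Set (Icc (0 : ℝ) T)} (hD : Dense D)
    (h : ∀ t ∈ D, f t = g t) (hend : ∀ t : Icc (0 : ℝ) T, (t : ℝ) = T → f t = g t) : f = g := by
  funext t
  -- Right-continuity says nothing at `T`, which has no points to its right; hence `hend`.
  rcases t.2.2.eq_or_lt with hT | hT
  · exact hend t hT
  have hne : (𝓝[>] t).NeBot :=
    nhdsGT_neBot_of_exists_gt ⟨⟨T, t.2.1.trans t.2.2, le_rfl⟩, hT⟩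
  have hfreq : ∃ᶠ s in 𝓝[>] t, s ∈ D := fun hev => by
    obtain ⟨u, hu, htu⟩ := (mem_nhdsGT_iff_exists_Ioo_subset'
      (show t < ⟨T, t.2.1.trans t.2.2, le_rfl⟩ from hT)).1 hev
    obtain ⟨s, hsD, hs⟩ := hD.exists_between hu
    exact htu hs hsD
  exact tendsto_nhds_unique_of_frequently_eq ((hf t).mono Ioi_subset_Ici_self)
    ((hg t).mono Ioi_subset_Ici_self) (hfreq.mono h)

end SkorohodSpace

/-! ### The Borel set of paths determined by their jumps -/

namespace SkorohodSpace

variable {H : Type*} [NormedAddCommGroup H] [NormedSpace ℝ H] [CompleteSpace H]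
  [SecondCountableTopology H] [MeasurableSpace H] [BorelSpace H] {T : ℝ}

/-- The approximations of the jump part at time `t`, as functions of the path. -/
noncomputable def approxJumpPart (E : ℕ → Set H) (b : ℕ → H) (t : Icc (0 : ℝ) T) (n : ℕ)
    (f : SkorohodSpace H T) : H :=
  (∑ᶠ s ∈ {s | s ≤ t ∧ f.jumpAt s ∈ (Metric.closedBall (0 : H) 1)ᶜ}, f.jumpAt s) +
    ((∑ᶠ s ∈ {s | s ≤ t ∧ f.jumpAt s ∈ Metric.closedBall (0 : H) 1 \ E n}, f.jumpAt s) - b n)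

lemma measurable_approxJumpPart {E : ℕ → Set H} (hE : IsShrinking E) (b : ℕ → H)
    (t : Icc (0 : ℝ) T) (n : ℕ) : Measurable (approxJumpPart E b t n) := by
  obtain ⟨r, hr, hEr⟩ := hE.boundedBelow n
  -- `boundedBelow` gives only `r ≤ ‖u‖`; halving `r` makes the inequality strict.
  refine (measurable_finsum_jumpAt Metric.isClosed_closedBall.measurableSet.compl one_pos
    (fun u hu => ?_) t).add ((measurable_finsum_jumpAt
      (Metric.isClosed_closedBall.measurableSet.diff (hE.measurableSet n)) (half_pos hr)
      (fun u hu => ?_) t).sub_const _)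
  · simpa using hu
  · exact (half_lt_self hr).trans_le (hEr u hu)

/-- The paths whose jump part at time `t` is `f(t) - A ∫_0^t f(s) ds`. -/
def jumpPartSet (hT : 0 ≤ T) (A : H →L[ℝ] H) (E : ℕ → Set H) (b : ℕ → H) (t : Icc (0 : ℝ) T) :
    Set (SkorohodSpace H T) :=
  {f | Tendsto (fun n => approxJumpPart E b t n f) atTop
    (𝓝 (f.path t - A (∫ s in (0 : ℝ)..t, IccExtend hT f.path s)))}

lemma measurableSet_jumpPartSet (hT : 0 ≤ T) (A : H →L[ℝ] H) {E : ℕ → Set H}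
    (hE : IsShrinking E) (b : ℕ → H) (t : Icc (0 : ℝ) T) :
    MeasurableSet (jumpPartSet hT A E b t) := by
  exact measurableSet_tendsto_fun (fun n => (measurable_approxJumpPart hE b t n))
    ((measurable_eval t).sub (A.measurable.comp (measurable_intervalIntegral_iccExtend hT 0 t)))

end SkorohodSpace

/-! ### Transfer from one solution to the other -/

open SkorohodSpace

/-- The continuous drift leaves the jumps of `L` unchanged, so the approximations can be read off
the path of `X`. The compensators depend only on `L` and `P`, hence are the same for both solutions.
-/
lemma IsOUSolution.ae_tendsto_approxJumpPart {H Ω : Type*} [NormedAddCommGroup H] [NormedSpace ℝ H]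
    [SecondCountableTopology H] [MeasurableSpace H] [MeasurableSpace Ω]
    {P : Measure Ω} {L Z : ℝ≥0 → Ω → H} {T : ℝ} {hT : 0 ≤ T} {A : H →L[ℝ] H}
    {X : Ω → SkorohodSpace H T} (hX : IsOUSolution hT A L P X)
    (hL : ∀ᵐ ω ∂P, IsCadlag fun t => L t ω) {E : ℕ → Set H} (t : Icc (0 : ℝ) T)
    (hZ : ∀ᵐ ω ∂P, Tendsto (fun n => jumpSum (Metric.closedBall 0 1)ᶜ (fun s => L s ω) (time t) +
      compensatedJumpSum L P (Metric.closedBall 0 1 \ E n) (time t) ω) atTop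
        (𝓝 (Z (time t) ω))) :
    ∀ᵐ ω ∂P, Tendsto (fun n => approxJumpPart E (fun n => (t : ℝ) •
      ∫ u in Metric.closedBall 0 1 \ E n, u ∂(intensityMeasure L P)) t n (X ω)) atTop
        (𝓝 (Z (time t) ω)) := by
  filter_upwards [hX.equation, hL, hZ] with ω hXω hLω hω
  have hjump := jumpAt_eq_jump (continuous_apply_intervalIntegral hT A (X ω)) hLω hXω
  simpa only [approxJumpPart, compensatedJumpSum, jumpSum_eq_finsum_jumpAt hjump, coe_time] using hω

theorem theoremB {H Ω : Type*} [NormedAddCommGroup H] [InnerProductSpace ℝ H] [CompleteSpace H]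
    [TopologicalSpace.SeparableSpace H] [MeasurableSpace H] [BorelSpace H]
    [MeasurableSpace Ω] (P : Measure Ω) [IsProbabilityMeasure P]
    (L : ℝ≥0 → Ω → H) (hL : IsLevyProcess L P) (hJ : IsPurelyJump L P)
    (A A' : H →L[ℝ] H) (T : ℝ) (hT : 0 < T) (X X' : Ω → SkorohodSpace H T)
    (hX : IsOUSolution hT.le A L P X) (hX' : IsOUSolution hT.le A' L P X')
    (hac : P.map X ≪ P.map X') :
    ∀ᵐ ω ∂P, X ω = X' ω := 
by
  have := UniformSpace.secondCountable_of_separable H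
  obtain ⟨E, hE, hlim⟩ := hJ
  have hpure : ∀ t : Icc (0 : ℝ) T, ∀ᵐ ω ∂P,
      L (time t) ω = (X ω).path t - A' (∫ s in (0 : ℝ)..t, IccExtend hT.le (X ω).path s) := by
    intro t
    have hmeas := measurableSet_jumpPartSet hT.le A' hE (fun n => (t : ℝ) •
      ∫ u in Metric.closedBall 0 1 \ E n, u ∂(intensityMeasure L P)) t
    have hX'mem : ∀ᵐ f ∂(P.map X'), f ∈ jumpPartSet hT.le A' E (fun n => (t : ℝ) •
        ∫ u in Metric.closedBall 0 1 \ E n, u ∂(intensityMeasure L P)) t := by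
      refine (mem_ae_map_iff hX'.measurable.aemeasurable hmeas).2 ?_
      filter_upwards [hX'.ae_tendsto_approxJumpPart hL.cadlag t (hlim _), hX'.equation]
        with ω hω hXω
      have hLt : L (time t) ω =
          (X' ω).path t - A' (∫ s in (0 : ℝ)..t, IccExtend hT.le (X' ω).path s) :=
        eq_sub_of_add_eq' (hXω t).symm
      rw [hLt] at hω
      exact hω
    -- Along `X` one sequence has two limits: `L_t` from the jumps, and `X_t - A' ∫₀ᵗ X` from
    -- absolute continuity.
    filter_upwards [hX.ae_tendsto_approxJumpPart hL.cadlag t (hlim _),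
      ae_of_ae_map hX.measurable.aemeasurable (hac.ae_le hX'mem)] with ω hω hω'
    exact tendsto_nhds_unique hω hω'
  -- The null set in `hpure` depends on `t`; countably many times, with `T` added, leave a single
  -- null set.
  obtain ⟨D, hDc, hD⟩ := TopologicalSpace.exists_countable_dense (Icc (0 : ℝ) T)
  filter_upwards [(ae_ball_iff hDc).2 fun t _ => hpure t, hpure ⟨T, hT.le, le_rfl⟩, hL.cadlag,
    hX'.equation] with ω hDω hTω hLω hX'ω
  have hLX : (fun t : Icc (0 : ℝ) T => L (time t) ω) =
      fun t => (X ω).path t - A' (∫ s in (0 : ℝ)..t, IccExtend hT.le (X ω).path s) := by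
    refine path_eq_of_dense (fun t => ?_) (fun t => ?_) hD hDω fun t ht => ?_
    · exact ContinuousWithinAt.comp (t := Ici (time t)) (hLω (time t)).1
        continuous_time.continuousWithinAt fun s hs => hs
    · exact ((X ω).isCadlag t).1.sub
        (continuous_apply_intervalIntegral hT.le A' (X ω)).continuousWithinAt
    · obtain rfl : t = ⟨T, hT.le, le_rfl⟩ := Subtype.ext ht
      exact hTω
  exact eq_of_integral_equation hT.le A' (l := fun t => L (time t) ω)
    (fun t => (add_eq_of_eq_sub' (congrFun hLX t)).symm) hX'ω
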